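/- Let $\mathbb{H}$ be the upper half plane with the metric $(dx^2+dy^2)/y^2$, let $T_1\mathbb{H}$ be its unit tangent bundle, let $T_1\mathcal{M}=\mathrm{PSL}_2(\mathbb{Z})\backslash T_1\mathbb{H}$ be the unit tangent bundle of the modular surface, and let $g_t$ denote the geodesic flow on both. For $(z,v)\in T_1\mathbb{H}$ let $\alpha(z,v)$ and $\beta(z,v)$ be the endpoints of its geodesic at times $-\infty$ and $+\infty$. Let $\bar X\subset T_1\mathcal{M}$ be the set of classes of those $(z,v)$ with $z\in i\mathbb{R}_{>0}$, $\alpha(z,v)\in\mathbb{R}\setminus\{0\}$, $\beta(z,v)\in\mathbb{R}$ and $|\beta(z,v)|\ge 1$, and give such a class the coordinates $$(U,W,\epsilon)=\left(|\beta|^{-1},\,(1+|\alpha|)^{-1},\,\operatorname{sign}\beta\right)\in(0,1]\times(0,1)\times\{\pm1\}.$$ Let $\tilde F:[0,1]^2\to[0,1]^2$ be the natural extension of the Farey map, $$\tilde F(x,y)=\begin{cases}\left(\frac{x}{1-x},\frac{y}{1+y}\right)&\text{if }0\le x\le\frac12,\\[4pt]\left(\frac{1-x}{x},\frac{1}{1+y}\right)&\text{if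 }\frac12<x\le1.\end{cases}$$ Then $\bar X$ is the set of classes of all nonvertical unit vectors based on the positive imaginary axis. Every triple in $(0,1]\times(0,1)\times\{\pm1\}$ is a coordinate triple of exactly one point of $\bar X$, and every point of $\bar X$ has such a triple. The triple is unique, except that $(1,W,\epsilon)$ and $(1,1-W,-\epsilon)$ denote the same point. The first return time $\bar r(x)=\min\{s>0: g_s(x)\in\bar X\}$ and the first return map $\bar P(x)=g_{\bar r(x)}(x)$ are defined exactly on the set $\bar X^*$ of the points $x\in\bar X$ with $U<1$. For all $(U,W,\epsilon)\in(0,1)^2\times\{\pm1\}$, $$\bar P(U,W,\epsilon)=\begin{cases}(\tilde F(U,W),\epsilon)&\text{if }0<U\le\frac12,\\(\tilde F(U,W),-\epsilon)&\text{if }\frac12<U<1,\end{cases}\qquad \bar r(U,W,\epsilon)=-\tfrac12\log\big((1-U)(1-W)\big).$$ Consequently $\tilde F$ is a factor of $\bar P$: if $\bar\pi:\bar X\to[0,1]^2$ is the map $(U,W,\epsilon)\mapsto(U,W)$, where the triple with $W\le\frac12$ is used for a point with $U=1$, then $\bar\pi$ is well defined and $\bar\pi\circ\bar P=\tilde F\circ\bar\pi$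 on $\bar X^*$. -/

import Mathlib

open Set Filter Topology
open scoped UpperHalfPlane MatrixGroups

noncomputable section

namespace ModularFarey

/-- The unit tangent bundle `T₁ℍ` of the upper half plane with the metric `(dx² + dy²) / y²`: a
tangent vector `vec` at `base` has hyperbolic length `‖vec‖ / base.im`. -/
@[ext]
structure UnitTangent where
  base : ℍ
  vec : ℂ
  norm_vec : ‖vec‖ = base.im

theorem im_smul_eq (γ : SL(2, ℝ)) (z : ℍ) :
    (γ • z).im = z.im / ‖(γ 1 0 : ℂ) * (z : ℂ) + (γ 1 1 : ℂ)‖ ^ 2 := by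
  have h := UpperHalfPlane.im_smul_eq_div_normSq (γ : GL (Fin 2) ℝ) z
  rw [Complex.normSq_eq_norm_sq] at h
  have hs : ((γ : GL (Fin 2) ℝ) • z : ℍ) = γ • z := rfl
  rw [hs] at h
  simpa [UpperHalfPlane.denom] using h

/-- `SL(2, ℝ)` acts by Möbius maps and their derivatives, `γ (z, v) = (γ z, γ'(z) v)`, where
`γ'(z) = (c z + d)⁻²` for `γ` with lower row `c, d`. -/
instance : SMul SL(2, ℝ) UnitTangent where
  smul γ p :=
    { base := γ • p.base
      vec := p.vec / ((γ 1 0 : ℂ) * (p.base : ℂ) + (γ 1 1 : ℂ)) ^ 2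
      norm_vec := by rw [norm_div, norm_pow, p.norm_vec, im_smul_eq] }

theorem base_smul (γ : SL(2, ℝ)) (p : UnitTangent) : (γ • p).base = γ • p.base := rfl

theorem vec_smul (γ : SL(2, ℝ)) (p : UnitTangent) :
    (γ • p).vec = p.vec / ((γ 1 0 : ℂ) * (p.base : ℂ) + (γ 1 1 : ℂ)) ^ 2 := rfl

instance : MulAction SL(2, ℝ) UnitTangent where
  one_smul p := by
    apply UnitTangent.ext
    · rw [base_smul, one_smul]
    · rw [vec_smul]; simp
  mul_smul g h p := by
    apply UnitTangent.ext
    · rw [base_smul, base_smul, base_smul, mul_smul]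
    · rw [vec_smul, vec_smul, vec_smul, base_smul]
      have key := UpperHalfPlane.denom_cocycle' (g : GL (Fin 2) ℝ) (h : GL (Fin 2) ℝ) p.base
      have hs : UpperHalfPlane.smulAux (h : GL (Fin 2) ℝ) p.base = h • p.base := rfl
      have hk : (((g * h : SL(2, ℝ)) 1 0 : ℝ) : ℂ) * (p.base : ℂ)
            + (((g * h : SL(2, ℝ)) 1 1 : ℝ) : ℂ)
          = ((g 1 0 : ℂ) * ((h • p.base : ℍ) : ℂ) + (g 1 1 : ℂ))
            * ((h 1 0 : ℂ) * (p.base : ℂ) + (h 1 1 : ℂ)) := by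
        have h2 : UpperHalfPlane.σ (h : GL (Fin 2) ℝ) = ContinuousAlgEquiv.refl ℝ ℂ := by
          simp [UpperHalfPlane.σ]
        rw [h2, hs] at key
        simpa [UpperHalfPlane.denom] using key
      rw [hk, mul_pow, mul_comm, div_div]

/-- The modular group acts on `T₁ℍ` through `SL(2, ℤ) → SL(2, ℝ)`. Since `-1` acts trivially, its
orbits are those of `PSL(2, ℤ)`. -/
instance : MulAction SL(2, ℤ) UnitTangent :=
  MulAction.compHom UnitTangent (Matrix.SpecialLinearGroup.map (n := Fin 2) (Int.castRingHom ℝ))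

/-- The upward-pointing unit vector at `i`. -/
def upVector : UnitTangent where
  base := UpperHalfPlane.I
  vec := Complex.I
  norm_vec := by simp

theorem exists_smul_upVector (p : UnitTangent) : ∃ γ : SL(2, ℝ), γ • upVector = p := by
  have hy : (0 : ℝ) < p.base.im := p.base.im_pos
  have hv : p.vec ≠ 0 := by
    intro h
    have := p.norm_vec
    rw [h, norm_zero] at this
    exact hy.ne this
  obtain ⟨w, hw⟩ : ∃ w : ℂ, w ^ 2 = Complex.I * (p.base.im : ℂ) / p.vec :=
    IsAlgClosed.exists_pow_nat_eq _ (by norm_num)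
  have hn : w.re ^ 2 + w.im ^ 2 = 1 := by
    have h1 : ‖w‖ ^ 2 = 1 := by
      rw [← norm_pow, hw, norm_div, norm_mul, Complex.norm_I, p.norm_vec, one_mul,
        Complex.norm_real, Real.norm_of_nonneg hy.le, div_self hy.ne']
    rw [← Complex.normSq_eq_norm_sq, Complex.normSq_apply] at h1
    nlinarith
  have hw0 : w ≠ 0 := by
    rintro rfl
    simp at hn
  let k : SL(2, ℝ) := ⟨!![w.re, -w.im; w.im, w.re], by rw [Matrix.det_fin_two_of]; nlinarith⟩
  have hkd : (k 1 0 : ℂ) * ((UpperHalfPlane.I : ℍ) : ℂ) + (k 1 1 : ℂ) = w := by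
    apply Complex.ext <;> simp [k]
  have hkI : k • UpperHalfPlane.I = UpperHalfPlane.I := by
    apply UpperHalfPlane.ext
    rw [UpperHalfPlane.specialLinearGroup_apply]
    have hnum : ((k 0 0 : ℝ) : ℂ) * Complex.I + ((k 0 1 : ℝ) : ℂ) = Complex.I * w := by
      apply Complex.ext <;> simp [k]
    have hkd' : ((k 1 0 : ℝ) : ℂ) * Complex.I + ((k 1 1 : ℝ) : ℂ) = w := hkd
    simp only [UpperHalfPlane.coe_I, Algebra.algebraMap_self, RingHom.id_apply]
    change (((k 0 0 : ℝ) : ℂ) * Complex.I + ((k 0 1 : ℝ) : ℂ))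
      / (((k 1 0 : ℝ) : ℂ) * Complex.I + ((k 1 1 : ℝ) : ℂ)) = Complex.I
    rw [hnum, hkd', mul_div_assoc, div_self hw0, mul_one]
  refine ⟨p.base.toSL2R * k, ?_⟩
  rw [mul_smul]
  apply UnitTangent.ext
  · rw [base_smul, base_smul]
    change p.base.toSL2R • (k • UpperHalfPlane.I) = p.base
    rw [hkI, UpperHalfPlane.toSL2R_smul_I]
  · rw [vec_smul, vec_smul]
    change Complex.I / ((k 1 0 : ℂ) * ((UpperHalfPlane.I : ℍ) : ℂ) + (k 1 1 : ℂ)) ^ 2 / _ = _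
    rw [hkd, hw]
    have hs : ((√p.base.im : ℝ) : ℂ) ^ 2 = (p.base.im : ℂ) := by
      rw [← Complex.ofReal_pow, Real.sq_sqrt hy.le]
    have hyc : (p.base.im : ℂ) ≠ 0 := by exact_mod_cast hy.ne'
    simp only [UpperHalfPlane.coe_toSL2R, Matrix.of_apply, Matrix.cons_val', Matrix.cons_val_zero,
      Matrix.cons_val_one, Matrix.cons_val_fin_one, Complex.ofReal_zero, zero_mul, zero_add,
      Complex.ofReal_div, Complex.ofReal_one, div_pow, one_pow, hs]
    field_simp

/-- The diagonal matrix with entries `exp (t / 2)` and `exp (-t / 2)`. -/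
def diagExp (t : ℝ) : SL(2, ℝ) :=
  ⟨!![Real.exp (t / 2), 0; 0, Real.exp (-t / 2)], by
    rw [Matrix.det_fin_two_of, ← Real.exp_add]; simp [neg_div]⟩

/-- The geodesic flow on `T₁ℍ`. The unit speed geodesic that leaves `i` upwards has at time `t` the
tangent vector `diagExp t • upVector`, that is, the vector `exp t • i` at the point `exp t • i`;
the isometry `γ` carries it to the unit speed geodesic with initial vector `γ • upVector`. -/
def geodesicFlow (t : ℝ) (p : UnitTangent) : UnitTangent :=
  ((exists_smul_upVector p).choose * diagExp t) • upVector

theorem smul_upVector_eq_self {k : SL(2, ℝ)} (h : k • upVector = upVector) : k = 1 ∨ k = -1 := by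
  have hb : k • UpperHalfPlane.I = UpperHalfPlane.I := congrArg UnitTangent.base h
  have hv : Complex.I / ((k 1 0 : ℂ) * Complex.I + (k 1 1 : ℂ)) ^ 2 = Complex.I :=
    congrArg UnitTangent.vec h
  have hne : ((k 1 0 : ℂ) * Complex.I + (k 1 1 : ℂ)) ^ 2 ≠ 0 := by
    intro h0
    rw [h0, div_zero] at hv
    exact Complex.I_ne_zero hv.symm
  have hsq : ((k 1 0 : ℂ) * Complex.I + (k 1 1 : ℂ)) ^ 2 = 1 := by
    rw [div_eq_iff hne] at hv
    exact (mul_left_cancel₀ Complex.I_ne_zero (by rw [mul_one]; exact hv)).symm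
  have hb' := congrArg (fun z : ℍ => (z : ℂ)) hb
  simp only [UpperHalfPlane.specialLinearGroup_apply] at hb'
  have hd : ((k 1 0 : ℂ) * Complex.I + (k 1 1 : ℂ)) ≠ 0 := fun h0 => hne (by rw [h0]; simp)
  have hb2 : ((k 0 0 : ℂ) * Complex.I + (k 0 1 : ℂ))
      = Complex.I * ((k 1 0 : ℂ) * Complex.I + (k 1 1 : ℂ)) := by
    rw [← div_eq_iff hd]
    exact hb'
  have e1 : k 0 1 = -k 1 0 := by simpa using congrArg Complex.re hb2
  have e2 : k 0 0 = k 1 1 := by simpa using congrArg Complex.im hb2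
  rcases sq_eq_one_iff.mp hsq with h1 | h1
  all_goals
    have a1 := congrArg Complex.re h1
    have a2 := congrArg Complex.im h1
    simp at a1 a2
  · left
    ext i j
    fin_cases i <;> fin_cases j <;> simp [e1, e2, a1, a2]
  · right
    ext i j
    fin_cases i <;> fin_cases j <;> simp [e1, e2, a1, a2]

/-- The geodesic flow corresponds to right multiplication by `diagExp t`. -/
theorem geodesicFlow_smul_upVector (t : ℝ) (γ : SL(2, ℝ)) :
    geodesicFlow t (γ • upVector) = (γ * diagExp t) • upVector := by
  unfold geodesicFlow
  set g := (exists_smul_upVector (γ • upVector)).choose with hg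
  have h : g • upVector = γ • upVector := (exists_smul_upVector (γ • upVector)).choose_spec
  have hk : (γ⁻¹ * g) • upVector = upVector := by
    rw [mul_smul, h, inv_smul_smul]
  have hneg (x : SL(2, ℝ)) : (-x) • upVector = x • upVector := by
    apply UnitTangent.ext
    · rw [base_smul, base_smul]
      apply UpperHalfPlane.ext
      simp only [UpperHalfPlane.specialLinearGroup_apply]
      simp only [Matrix.SpecialLinearGroup.coe_neg, Matrix.neg_apply, map_neg, Complex.ofReal_neg,
        neg_mul]
      rw [← neg_add, ← neg_add, neg_div_neg_eq]
    · rw [vec_smul, vec_smul]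
      simp only [Matrix.SpecialLinearGroup.coe_neg, Matrix.neg_apply, Complex.ofReal_neg, neg_mul]
      rw [← neg_add, neg_sq]
  rcases smul_upVector_eq_self hk with h1 | h1
  · rw [inv_mul_eq_one.mp h1]
  · rw [show g = -γ by rw [inv_mul_eq_iff_eq_mul] at h1; rw [h1]; simp, neg_mul, hneg]

theorem geodesicFlow_smul (t : ℝ) (γ : SL(2, ℝ)) (p : UnitTangent) :
    geodesicFlow t (γ • p) = γ • geodesicFlow t p := by
  obtain ⟨g, rfl⟩ := exists_smul_upVector p
  rw [← mul_smul, geodesicFlow_smul_upVector, geodesicFlow_smul_upVector, ← mul_smul, mul_assoc]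

/-- The unit tangent bundle `T₁ℳ = PSL(2, ℤ) \ T₁ℍ` of the modular surface. -/
abbrev ModularTangent : Type := MulAction.orbitRel.Quotient SL(2, ℤ) UnitTangent

/-- The projection `T₁ℍ → T₁ℳ`. -/
def toModular (p : UnitTangent) : ModularTangent := Quotient.mk _ p

/-- The geodesic flow on `T₁ℳ`. -/
def modularFlow (t : ℝ) : ModularTangent → ModularTangent :=
  Quotient.map (geodesicFlow t) (by
    rintro _ q ⟨γ, rfl⟩
    exact ⟨γ, (geodesicFlow_smul t _ q).symm⟩)

/-- `a` is the real endpoint at time `-∞` of the geodesic tangent to `p`. -/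
def IsBackwardEndpoint (p : UnitTangent) (a : ℝ) : Prop :=
  Tendsto (fun t : ℝ => ((geodesicFlow t p).base : ℂ)) atBot (𝓝 (a : ℂ))

/-- `b` is the real endpoint at time `∞` of the geodesic tangent to `p`. -/
def IsForwardEndpoint (p : UnitTangent) (b : ℝ) : Prop :=
  Tendsto (fun t : ℝ => ((geodesicFlow t p).base : ℂ)) atTop (𝓝 (b : ℂ))

/-- `p` is a vector with base point on the positive imaginary axis whose geodesic has the real
endpoints `a ≠ 0` (backward) and `b` with `1 ≤ |b|` (forward). -/
structure IsSectionLift (p : UnitTangent) (a b : ℝ) : Prop where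
  re_base : p.base.re = 0
  backward : IsBackwardEndpoint p a
  forward : IsForwardEndpoint p b
  backward_ne_zero : a ≠ 0
  one_le_abs_forward : 1 ≤ |b|

/-- The cross section of the geodesic flow on `T₁ℳ`. -/
def crossSection : Set ModularTangent :=
  {x | ∃ p a b, toModular p = x ∧ IsSectionLift p a b}

/-- The point `x` of the cross section has coordinates `(U, W, ε)`: it is represented by a vector
based on the positive imaginary axis with endpoints `α ≠ 0` (backward) and `β`, `|β| ≥ 1` (forward),
such that `U = |β|⁻¹`, `W = (1 + |α|)⁻¹` and `ε` is the sign of `β`. -/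
def HasCoordinates (x : ModularTangent) (U W : ℝ) (ε : ℤˣ) : Prop :=
  ∃ p a b, toModular p = x ∧ IsSectionLift p a b ∧
    U = |b|⁻¹ ∧ W = (1 + |a|)⁻¹ ∧ (((ε : ℤ) : ℝ)) = Real.sign b

/-- The positive times at which the orbit of `x` meets the cross section. -/
def returnTimes (x : ModularTangent) : Set ℝ := {s | 0 < s ∧ modularFlow s x ∈ crossSection}

/-- The points of the cross section for which a first return time exists. -/
def returnDomain : Set ModularTangent :=
  {x | x ∈ crossSection ∧ ∃ r, IsLeast (returnTimes x) r}

/-- The first return time (meaningful on `returnDomain`, where the infimum is a minimum). -/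
def returnTime (x : ModularTangent) : ℝ := sInf (returnTimes x)

/-- The first return map of the cross section. -/
def returnMap (x : returnDomain) : crossSection :=
  ⟨modularFlow (returnTime x) x, by
    obtain ⟨r, hr⟩ := x.2.2
    have h : returnTime x = r := hr.csInf_eq
    rw [h]
    exact hr.1.2⟩

/-- The natural extension of the Farey map (a self-map of the unit square `[0, 1]²`). -/
def fareyExtension (p : ℝ × ℝ) : ℝ × ℝ :=
  if p.1 ≤ 1 / 2 then (p.1 / (1 - p.1), p.2 / (1 + p.2))
  else ((1 - p.1) / p.1, 1 / (1 + p.2))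

/-- `π` is the projection `(U, W, ε) ↦ (U, W)` from the cross section to the plane. A point with
`U = 1` has two coordinate triples, `(1, W, ε)` and `(1, 1 - W, -ε)`, and `π` reads off the one
with `W ≤ 1 / 2`. -/
def IsCoordinateProjection (π : crossSection → ℝ × ℝ) : Prop :=
  ∀ (x : crossSection) (U W : ℝ) (ε : ℤˣ),
    HasCoordinates x U W ε → (U < 1 ∨ W ≤ 1 / 2) → π x = (U, W)

end ModularFarey

end

open ModularFarey

namespace ModularFarey

/-! The translates of the imaginary axis under the modular group are the edges of the Farey
tessellation, so the flow meets the section only at times when a lift is on an edge. A vector on the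
axis is determined by its endpoints α, β, which have opposite signs (`endpoints_mul_neg`,
`eq_of_endpoints`, `exists_endpoints`). The elements carrying a point of the axis to the axis are ±1
and ±S (`stabilizer_imaginary_axis`). Since S inverts |β|, every nonvertical vector on the axis has
a lift with |β| ≥ 1, and coordinates are ambiguous only when |β| = 1.

Put α = -ε(1/W - 1) and β = ε/U. The geodesic enters the ideal triangle 0, ε, ∞, whose interior
meets no edge (`farey_triangle_interior`). As |β| ≥ 1, it either ends at the vertex ε, if U = 1, or
leaves through the line Re z = ε. Solving Re z = ε for the time gives exp(2s) = 1/((1 - U)(1 - W)).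
Translation by -ε turns the endpoints into -ε/W and ε(1 - U)/U. If U ≤ 1/2, the new |β| is at least
1 and the first branch of the Farey extension appears. Otherwise S must be applied as well, which
gives the second branch and reverses ε (`HasCoordinates.flow_return`). -/

/-! ### The action and the flow in matrix entries -/

theorem coe_smul_eq (g : SL(2, ℝ)) (z : ℍ) :
    ((g • z : ℍ) : ℂ) = ((g 0 0 : ℂ) * z + (g 0 1 : ℂ)) / ((g 1 0 : ℂ) * z + (g 1 1 : ℂ)) := by
  rw [UpperHalfPlane.specialLinearGroup_apply]
  rfl

theorem re_smul (g : SL(2, ℝ)) (z : ℍ) :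
    (g • z).re = (g 0 0 * g 1 0 * (z.re ^ 2 + z.im ^ 2) + (g 0 0 * g 1 1 + g 0 1 * g 1 0) * z.re
      + g 0 1 * g 1 1) / ((g 1 0 * z.re + g 1 1) ^ 2 + (g 1 0 * z.im) ^ 2) := by
  rw [← UpperHalfPlane.coe_re, coe_smul_eq, Complex.div_re, ← add_div, Complex.normSq_apply]
  simp
  congr 1 <;> ring

theorem im_smul_eq_div (g : SL(2, ℝ)) (z : ℍ) :
    (g • z).im = z.im / ((g 1 0 * z.re + g 1 1) ^ 2 + (g 1 0 * z.im) ^ 2) := by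
  rw [im_smul_eq, ← Complex.normSq_eq_norm_sq, Complex.normSq_apply]
  simp
  congr 1
  ring

theorem det_eq_one (g : SL(2, ℝ)) : g 0 0 * g 1 1 - g 0 1 * g 1 0 = 1 := by
  have := g.det_coe
  rwa [Matrix.det_fin_two] at this

/-- The denominator |cz + d|² cannot vanish, so the numerator alone is the equation of the preimage
of the imaginary axis under `g`. For integral `g` this is the equation of a Farey edge. -/
theorem re_smul_eq_zero_iff (g : SL(2, ℝ)) (z : ℍ) :
    (g • z).re = 0 ↔ g 0 0 * g 1 0 * (z.re ^ 2 + z.im ^ 2)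
      + (g 0 0 * g 1 1 + g 0 1 * g 1 0) * z.re + g 0 1 * g 1 1 = 0 := by
  rw [re_smul, div_eq_zero_iff, or_iff_left]
  intro h
  have hz := z.im_pos.ne'
  have h1 : g 1 0 * z.im = 0 := by
    nlinarith [sq_nonneg (g 1 0 * z.re + g 1 1), sq_nonneg (g 1 0 * z.im)]
  have h2 : g 1 0 = 0 := (mul_eq_zero.mp h1).resolve_right hz
  have hd := det_eq_one g
  simp [h2] at h
  simp [h2, h] at hd

theorem base_smul_upVector (M : SL(2, ℝ)) :
    (M • upVector).base.re = (M 0 0 * M 1 0 + M 0 1 * M 1 1) / (M 1 0 ^ 2 + M 1 1 ^ 2) ∧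
    (M • upVector).base.im = 1 / (M 1 0 ^ 2 + M 1 1 ^ 2) := by
  rw [base_smul, re_smul, im_smul_eq_div]
  simp [upVector]
  constructor
  · congr 1
    ring
  · rw [add_comm]

theorem lower_row_pos (M : SL(2, ℝ)) : 0 < M 1 0 ^ 2 + M 1 1 ^ 2 := by
  have hd := det_eq_one M
  by_contra! h
  have h1 : M 1 0 = 0 := by nlinarith [sq_nonneg (M 1 0), sq_nonneg (M 1 1)]
  have h2 : M 1 1 = 0 := by nlinarith [sq_nonneg (M 1 0), sq_nonneg (M 1 1)]
  simp [h1, h2] at hd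

theorem vec_re_smul_upVector (M : SL(2, ℝ)) :
    (M • upVector).vec.re = 2 * M 1 0 * M 1 1 / (M 1 0 ^ 2 + M 1 1 ^ 2) ^ 2 := by
  rw [vec_smul, Complex.div_re, ← add_div, map_pow, Complex.normSq_apply]
  simp [upVector, pow_two]
  have := lower_row_pos M
  have h : M 1 0 * M 1 0 + M 1 1 * M 1 1 ≠ 0 := by nlinarith
  rw [show M 1 1 * M 1 1 + M 1 0 * M 1 0 = M 1 0 * M 1 0 + M 1 1 * M 1 1 by ring]
  field_simp
  ring

theorem neg_smul_tangent (g : SL(2, ℝ)) (p : UnitTangent) : (-g) • p = g • p := by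
  apply UnitTangent.ext
  · rw [base_smul, base_smul]
    apply UpperHalfPlane.ext
    rw [coe_smul_eq, coe_smul_eq]
    simp only [Matrix.SpecialLinearGroup.coe_neg, Matrix.neg_apply, Complex.ofReal_neg, neg_mul]
    rw [← neg_add, ← neg_add, neg_div_neg_eq]
  · rw [vec_smul, vec_smul]
    simp only [Matrix.SpecialLinearGroup.coe_neg, Matrix.neg_apply, Complex.ofReal_neg, neg_mul]
    rw [← neg_add, neg_sq]

theorem SL2_mul_apply (g h : SL(2, ℝ)) (i j : Fin 2) :
    (g * h) i j = g i 0 * h 0 j + g i 1 * h 1 j := by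
  change (g.1 * h.1) i j = _
  rw [Matrix.mul_apply, Fin.sum_univ_two]

theorem diagExp_apply (t : ℝ) :
    diagExp t 0 0 = Real.exp (t / 2) ∧ diagExp t 0 1 = 0 ∧
    diagExp t 1 0 = 0 ∧ diagExp t 1 1 = Real.exp (-t / 2) :=
  ⟨rfl, rfl, rfl, rfl⟩

theorem mul_diagExp_apply (M : SL(2, ℝ)) (t : ℝ) :
    (M * diagExp t) 0 0 = M 0 0 * Real.exp (t / 2) ∧
    (M * diagExp t) 0 1 = M 0 1 * Real.exp (-t / 2) ∧
    (M * diagExp t) 1 0 = M 1 0 * Real.exp (t / 2) ∧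
    (M * diagExp t) 1 1 = M 1 1 * Real.exp (-t / 2) := by
  obtain ⟨e1, e2, e3, e4⟩ := diagExp_apply t
  simp [SL2_mul_apply, e1, e2, e3, e4]

theorem exp_half_sq (t : ℝ) : Real.exp (t / 2) ^ 2 = Real.exp t := by
  rw [← Real.exp_nat_mul]; congr 1; push_cast; ring

theorem geodesicFlow_add (s t : ℝ) (p : UnitTangent) :
    geodesicFlow t (geodesicFlow s p) = geodesicFlow (s + t) p := by
  obtain ⟨M, rfl⟩ := exists_smul_upVector p
  rw [geodesicFlow_smul_upVector, geodesicFlow_smul_upVector, geodesicFlow_smul_upVector, mul_assoc]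
  congr 2
  ext i j
  rw [SL2_mul_apply]
  fin_cases i <;> fin_cases j <;> simp [diagExp, ← Real.exp_add] <;> ring

theorem flow_base (M : SL(2, ℝ)) (t : ℝ) :
    (geodesicFlow t (M • upVector)).base.re
      = (M 0 0 * M 1 0 * Real.exp t + M 0 1 * M 1 1 * Real.exp (-t))
        / (M 1 0 ^ 2 * Real.exp t + M 1 1 ^ 2 * Real.exp (-t)) ∧
    (geodesicFlow t (M • upVector)).base.im
      = 1 / (M 1 0 ^ 2 * Real.exp t + M 1 1 ^ 2 * Real.exp (-t)) := by
  rw [geodesicFlow_smul_upVector]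
  obtain ⟨h1, h2⟩ := base_smul_upVector (M * diagExp t)
  obtain ⟨e1, e2, e3, e4⟩ := mul_diagExp_apply M t
  rw [h1, h2, e1, e2, e3, e4, ← exp_half_sq t, ← exp_half_sq (-t)]
  constructor <;> congr 1 <;> ring

/-! ### Endpoints of geodesics -/

theorem isForwardEndpoint_smul_upVector {M : SL(2, ℝ)} (h : M 1 0 ≠ 0) :
    IsForwardEndpoint (M • upVector) (M 0 0 / M 1 0) := by
  have key (t : ℝ) : ((geodesicFlow t (M • upVector)).base : ℂ)
      = ((M 0 0 : ℂ) * Complex.I + (M 0 1 * Real.exp (-t) : ℝ))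
        / ((M 1 0 : ℂ) * Complex.I + (M 1 1 * Real.exp (-t) : ℝ)) := by
    rw [geodesicFlow_smul_upVector, base_smul, coe_smul_eq]
    obtain ⟨e1, e2, e3, e4⟩ := mul_diagExp_apply M t
    rw [e1, e2, e3, e4]
    have h1 : Real.exp (-t / 2) = Real.exp (t / 2) * Real.exp (-t) := by
      rw [← Real.exp_add]; congr 1; ring
    have h2 : ((Real.exp (t / 2) : ℝ) : ℂ) ≠ 0 := by exact_mod_cast (Real.exp_pos _).ne'
    rw [h1, ← mul_div_mul_left _ ((M 1 0 : ℂ) * _ + _) h2]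
    simp only [upVector, UpperHalfPlane.coe_I]
    push_cast
    congr 1 <;> ring
  unfold IsForwardEndpoint
  simp_rw [key]
  have he : Tendsto (fun t : ℝ => Real.exp (-t)) atTop (𝓝 0) :=
    Real.tendsto_exp_neg_atTop_nhds_zero
  have hc (m n : ℝ) : Tendsto (fun t : ℝ => (m : ℂ) * Complex.I + (n * Real.exp (-t) : ℝ)) atTop
      (𝓝 (m * Complex.I)) := by
    have h3 : Tendsto (fun t : ℝ => ((n * Real.exp (-t) : ℝ) : ℂ)) atTop (𝓝 ((n * 0 : ℝ) : ℂ)) :=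
      (Complex.continuous_ofReal.tendsto _).comp (he.const_mul n)
    simpa using h3.const_add ((m : ℂ) * Complex.I)
  have hne : (M 1 0 : ℂ) * Complex.I ≠ 0 := mul_ne_zero (by exact_mod_cast h) Complex.I_ne_zero
  have := (hc (M 0 0) (M 0 1)).div (hc (M 1 0) (M 1 1)) hne
  rw [mul_div_mul_right _ _ Complex.I_ne_zero] at this
  rw [Complex.ofReal_div]
  exact this

theorem isBackwardEndpoint_smul_upVector {M : SL(2, ℝ)} (h : M 1 1 ≠ 0) :
    IsBackwardEndpoint (M • upVector) (M 0 1 / M 1 1) := by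
  have key (t : ℝ) : ((geodesicFlow t (M • upVector)).base : ℂ)
      = (((M 0 0 * Real.exp t : ℝ) : ℂ) * Complex.I + (M 0 1 : ℂ))
        / (((M 1 0 * Real.exp t : ℝ) : ℂ) * Complex.I + (M 1 1 : ℂ)) := by
    rw [geodesicFlow_smul_upVector, base_smul, coe_smul_eq]
    obtain ⟨e1, e2, e3, e4⟩ := mul_diagExp_apply M t
    rw [e1, e2, e3, e4]
    have h1 : Real.exp (t / 2) = Real.exp (-t / 2) * Real.exp t := by
      rw [← Real.exp_add]; congr 1; ring
    have h2 : ((Real.exp (-t / 2) : ℝ) : ℂ) ≠ 0 := by exact_mod_cast (Real.exp_pos _).ne'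
    rw [h1, ← mul_div_mul_left _ (_ * Complex.I + (M 1 1 : ℂ)) h2]
    simp only [upVector, UpperHalfPlane.coe_I]
    push_cast
    congr 1 <;> ring
  unfold IsBackwardEndpoint
  simp_rw [key]
  have hc (m n : ℝ) : Tendsto (fun t : ℝ => ((m * Real.exp t : ℝ) : ℂ) * Complex.I + (n : ℂ)) atBot
      (𝓝 n) := by
    have h3 : Tendsto (fun t : ℝ => ((m * Real.exp t : ℝ) : ℂ)) atBot (𝓝 ((m * 0 : ℝ) : ℂ)) :=
      (Complex.continuous_ofReal.tendsto _).comp (Real.tendsto_exp_atBot.const_mul m)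
    simpa using (h3.mul_const Complex.I).add_const (n : ℂ)
  have hne : (M 1 1 : ℂ) ≠ 0 := by exact_mod_cast h
  rw [Complex.ofReal_div]
  exact (hc (M 0 0) (M 0 1)).div (hc (M 1 0) (M 1 1)) hne

/-- The forward endpoint is the image of ∞ under `M`. If `M 1 0 = 0`, the height grows like exp t
and no real limit exists. The division-free form can be substituted into the determinant and into
the equation of the axis. -/
theorem isForwardEndpoint_iff {M : SL(2, ℝ)} {b : ℝ} :
    IsForwardEndpoint (M • upVector) b ↔ M 1 0 ≠ 0 ∧ M 0 0 = b * M 1 0 := by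
  constructor
  · intro hb
    have h : M 1 0 ≠ 0 := by
      intro h0
      have him := (Complex.continuous_im.tendsto _).comp hb
      have h1 : M 1 1 ≠ 0 := by
        intro h1
        have := lower_row_pos M
        simp [h0, h1] at this
      refine not_tendsto_nhds_of_tendsto_atTop ?_ _ him
      have : (Complex.im ∘ fun t : ℝ => ((geodesicFlow t (M • upVector)).base : ℂ))
          = fun t => (1 / M 1 1 ^ 2) * Real.exp t := by
        funext t
        simp [(flow_base M t).2, h0, Real.exp_neg]
        ring
      rw [this]
      exact Real.tendsto_exp_atTop.const_mul_atTop (by positivity)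
    refine ⟨h, ?_⟩
    have := tendsto_nhds_unique hb (isForwardEndpoint_smul_upVector h)
    rw [Complex.ofReal_inj.mp this, div_mul_cancel₀ _ h]
  · rintro ⟨h, h1⟩
    have := isForwardEndpoint_smul_upVector h
    rwa [h1, mul_div_cancel_right₀ _ h] at this

theorem isBackwardEndpoint_iff {M : SL(2, ℝ)} {a : ℝ} :
    IsBackwardEndpoint (M • upVector) a ↔ M 1 1 ≠ 0 ∧ M 0 1 = a * M 1 1 := by
  constructor
  · intro ha
    have h : M 1 1 ≠ 0 := by
      intro h0
      have him := (Complex.continuous_im.tendsto _).comp ha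
      have h1 : M 1 0 ≠ 0 := by
        intro h1
        have := lower_row_pos M
        simp [h0, h1] at this
      refine not_tendsto_nhds_of_tendsto_atTop ?_ _ him
      have : (Complex.im ∘ fun t : ℝ => ((geodesicFlow t (M • upVector)).base : ℂ))
          = fun t => (1 / M 1 0 ^ 2) * Real.exp (-t) := by
        funext t
        simp [(flow_base M t).2, h0, Real.exp_neg]
        ring
      rw [this]
      exact (Real.tendsto_exp_atTop.comp tendsto_neg_atBot_atTop).const_mul_atTop (by positivity)
    refine ⟨h, ?_⟩
    have := tendsto_nhds_unique ha (isBackwardEndpoint_smul_upVector h)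
    rw [Complex.ofReal_inj.mp this, div_mul_cancel₀ _ h]
  · rintro ⟨h, h1⟩
    have := isBackwardEndpoint_smul_upVector h
    rwa [h1, mul_div_cancel_right₀ _ h] at this

theorem base_re_eq_zero_iff {M : SL(2, ℝ)} :
    (M • upVector).base.re = 0 ↔ M 0 0 * M 1 0 + M 0 1 * M 1 1 = 0 := by
  rw [(base_smul_upVector M).1, div_eq_zero_iff, or_iff_left (lower_row_pos M).ne']

/-- A vector is vertical exactly when one of its endpoints, the images of ∞ and 0 under `M`, is ∞.
-/
theorem vec_re_ne_zero_iff {M : SL(2, ℝ)} :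
    (M • upVector).vec.re ≠ 0 ↔ M 1 0 ≠ 0 ∧ M 1 1 ≠ 0 := by
  have := lower_row_pos M
  rw [vec_re_smul_upVector, div_ne_zero_iff, mul_ne_zero_iff, mul_ne_zero_iff]
  simp [this.ne']

theorem tendsto_coe_smul {l : Filter ℝ} {f : ℝ → ℍ} {b : ℝ} (g : SL(2, ℝ))
    (hf : Tendsto (fun t => (f t : ℂ)) l (𝓝 b)) (h : g 1 0 * b + g 1 1 ≠ 0) :
    Tendsto (fun t => ((g • f t : ℍ) : ℂ)) l
      (𝓝 (((g 0 0 * b + g 0 1) / (g 1 0 * b + g 1 1) : ℝ) : ℂ)) := by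
  simp_rw [coe_smul_eq]
  push_cast
  refine ((hf.const_mul _).add_const _).div ((hf.const_mul _).add_const _) ?_
  exact_mod_cast h

theorem IsForwardEndpoint.smul {p : UnitTangent} {b : ℝ} (hb : IsForwardEndpoint p b)
    (g : SL(2, ℝ)) (h : g 1 0 * b + g 1 1 ≠ 0) :
    IsForwardEndpoint (g • p) ((g 0 0 * b + g 0 1) / (g 1 0 * b + g 1 1)) := by
  unfold IsForwardEndpoint
  simp_rw [geodesicFlow_smul, base_smul]
  exact tendsto_coe_smul g hb h

theorem IsBackwardEndpoint.smul {p : UnitTangent} {a : ℝ} (ha : IsBackwardEndpoint p a)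
    (g : SL(2, ℝ)) (h : g 1 0 * a + g 1 1 ≠ 0) :
    IsBackwardEndpoint (g • p) ((g 0 0 * a + g 0 1) / (g 1 0 * a + g 1 1)) := by
  unfold IsBackwardEndpoint
  simp_rw [geodesicFlow_smul, base_smul]
  exact tendsto_coe_smul g ha h

theorem IsForwardEndpoint.flow {p : UnitTangent} {b : ℝ} (hb : IsForwardEndpoint p b) (s : ℝ) :
    IsForwardEndpoint (geodesicFlow s p) b := by
  unfold IsForwardEndpoint
  simp_rw [geodesicFlow_add]
  exact (show Tendsto (fun t : ℝ => ((geodesicFlow t p).base : ℂ)) atTop (𝓝 b) from hb).comp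
    (tendsto_atTop_add_const_left _ s tendsto_id)

theorem IsBackwardEndpoint.flow {p : UnitTangent} {a : ℝ} (ha : IsBackwardEndpoint p a) (s : ℝ) :
    IsBackwardEndpoint (geodesicFlow s p) a := by
  unfold IsBackwardEndpoint
  simp_rw [geodesicFlow_add]
  exact (show Tendsto (fun t : ℝ => ((geodesicFlow t p).base : ℂ)) atBot (𝓝 a) from ha).comp
    (tendsto_atBot_add_const_left _ s tendsto_id)

/-! ### Geodesics crossing the imaginary axis -/

/-- The endpoints of a geodesic that crosses the imaginary axis have opposite signs. -/
theorem endpoints_mul_neg {p : UnitTangent} {a b : ℝ} (h0 : p.base.re = 0)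
    (ha : IsBackwardEndpoint p a) (hb : IsForwardEndpoint p b) : a * b < 0 := by
  obtain ⟨M, rfl⟩ := exists_smul_upVector p
  rw [isBackwardEndpoint_iff] at ha
  rw [isForwardEndpoint_iff] at hb
  rw [base_re_eq_zero_iff] at h0
  have hd := det_eq_one M
  rw [ha.2, hb.2] at h0 hd
  have h1 : 0 < M 1 0 ^ 2 := by have := hb.1; positivity
  have h2 : 0 < M 1 1 ^ 2 := by have := ha.1; positivity
  by_contra! h
  -- Multiplying the axis equation by `b` and by `a` gives two vanishing sums of nonnegative terms,
  -- which forces a = b = 0 against the determinant.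
  have h3 : M 1 0 ^ 2 * b ^ 2 + M 1 1 ^ 2 * (a * b) = 0 := by linear_combination b * h0
  have h4 : M 1 0 ^ 2 * (a * b) + M 1 1 ^ 2 * a ^ 2 = 0 := by linear_combination a * h0
  have hb0 : b = 0 := by
    have : M 1 0 ^ 2 * b ^ 2 = 0 := by
      nlinarith [mul_nonneg h2.le h, mul_nonneg h1.le (sq_nonneg b)]
    simpa [h1.ne', hb.1] using this
  have ha0 : a = 0 := by
    have : M 1 1 ^ 2 * a ^ 2 = 0 := by
      nlinarith [mul_nonneg h1.le h, mul_nonneg h2.le (sq_nonneg a)]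
    simpa [h2.ne', ha.1] using this
  simp [ha0, hb0] at hd

/-- A vector based on the imaginary axis is determined by the endpoints of its geodesic. -/
theorem eq_of_endpoints {p q : UnitTangent} {a b : ℝ} (hp0 : p.base.re = 0) (hq0 : q.base.re = 0)
    (hpa : IsBackwardEndpoint p a) (hpb : IsForwardEndpoint p b)
    (hqa : IsBackwardEndpoint q a) (hqb : IsForwardEndpoint q b) : p = q := by
  have hab := endpoints_mul_neg hp0 hpa hpb
  have key (M : SL(2, ℝ)) (h0 : (M • upVector).base.re = 0)
      (ha : IsBackwardEndpoint (M • upVector) a) (hb : IsForwardEndpoint (M • upVector) b) :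
      M 1 0 * M 1 1 * (b - a) = 1 ∧ M 1 0 ^ 2 * b + M 1 1 ^ 2 * a = 0 ∧ M 1 0 ≠ 0 ∧
        M 0 0 = b * M 1 0 ∧ M 0 1 = a * M 1 1 := by
    rw [isBackwardEndpoint_iff] at ha
    rw [isForwardEndpoint_iff] at hb
    rw [base_re_eq_zero_iff, ha.2, hb.2] at h0
    have hd := det_eq_one M
    rw [ha.2, hb.2] at hd
    exact ⟨by linarith, by linarith, hb.1, hb.2, ha.2⟩
  obtain ⟨M, rfl⟩ := exists_smul_upVector p
  obtain ⟨N, rfl⟩ := exists_smul_upVector q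
  obtain ⟨m1, m2, m3, m4, m5⟩ := key M hp0 hpa hpb
  obtain ⟨n1, n2, n3, n4, n5⟩ := key N hq0 hqa hqb
  have hb : b ≠ 0 := by rintro rfl; simp at hab
  have hba : b - a ≠ 0 := by intro h; rw [h] at m1; simp at m1
  -- Eliminating `M 1 1` leaves an equation for the fourth power of `M 1 0`. Hence `M` is determined
  -- up to sign, and the sign acts trivially.
  have hm : (M 1 0 ^ 2) ^ 2 * b * (b - a) ^ 2 = -a := by
    linear_combination M 1 0 ^ 2 * (b - a) ^ 2 * m2 - a * (M 1 0 * M 1 1 * (b - a) + 1) * m1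
  have hn : (N 1 0 ^ 2) ^ 2 * b * (b - a) ^ 2 = -a := by
    linear_combination N 1 0 ^ 2 * (b - a) ^ 2 * n2 - a * (N 1 0 * N 1 1 * (b - a) + 1) * n1
  have h1 : (M 1 0 ^ 2) ^ 2 = (N 1 0 ^ 2) ^ 2 :=
    mul_right_cancel₀ hb (mul_right_cancel₀ (pow_ne_zero 2 hba) (hm.trans hn.symm))
  have h2 : M 1 0 ^ 2 = N 1 0 ^ 2 := (pow_left_inj₀ (sq_nonneg _) (sq_nonneg _) two_ne_zero).mp h1
  rcases sq_eq_sq_iff_eq_or_eq_neg.mp h2 with h | h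
  · have h' : M 1 1 = N 1 1 := by
      have : N 1 0 * (b - a) * (M 1 1 - N 1 1) = 0 := by rw [h] at m1; linear_combination m1 - n1
      simpa [n3, hba, sub_eq_zero] using this
    have : M = N := by
      ext i j
      fin_cases i <;> fin_cases j <;> simp [m4, m5, n4, n5, h, h']
    rw [this]
  · have h' : M 1 1 = -N 1 1 := by
      have : N 1 0 * (b - a) * (M 1 1 + N 1 1) = 0 := by rw [h] at m1; linear_combination n1 - m1
      simpa [n3, hba, add_eq_zero_iff_eq_neg] using this
    have : M = -N := by
      ext i j
      fin_cases i <;> fin_cases j <;> simp [m4, m5, n4, n5, h, h']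
    rw [this, neg_smul_tangent]

/-- Take any matrix that sends ∞ to `b` and 0 to `a`, then flow until the geodesic meets the axis.
-/
theorem exists_endpoints {a b : ℝ} (hab : a * b < 0) :
    ∃ p : UnitTangent, p.base.re = 0 ∧ IsBackwardEndpoint p a ∧ IsForwardEndpoint p b := by
  have hb : b ≠ 0 := by rintro rfl; simp at hab
  have hba : b - a ≠ 0 := by
    intro h
    rw [sub_eq_zero.mp h] at hab
    nlinarith [mul_self_nonneg a]
  let M : SL(2, ℝ) := ⟨!![b, a / (b - a); 1, 1 / (b - a)], by
    rw [Matrix.det_fin_two_of]; field_simp⟩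
  have m00 : M 0 0 = b := rfl
  have m01 : M 0 1 = a / (b - a) := rfl
  have m10 : M 1 0 = 1 := rfl
  have m11 : M 1 1 = 1 / (b - a) := rfl
  have hE : 0 < -(a * b) / (b * (b - a)) ^ 2 := by
    have : 0 < -(a * b) := by linarith
    positivity
  -- The real part vanishes when exp(2t) = -a/(b(b - a)²); the fraction is expanded by `b` to make
  -- its sign visible.
  set t := Real.log (-(a * b) / (b * (b - a)) ^ 2) / 2 with ht
  refine ⟨geodesicFlow t (M • upVector), ?_, ?_, ?_⟩
  · have h2 : Real.exp t * Real.exp t = -(a * b) / (b * (b - a)) ^ 2 := by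
      rw [← Real.exp_add, ht, add_halves, Real.exp_log hE]
    rw [(flow_base M t).1, m00, m01, m10, m11, Real.exp_neg]
    have he := (Real.exp_pos t).ne'
    have h3 : b * 1 * Real.exp t + a / (b - a) * (1 / (b - a)) * (Real.exp t)⁻¹ = 0 := by
      have : b * 1 * Real.exp t + a / (b - a) * (1 / (b - a)) * (Real.exp t)⁻¹
        = (b * (Real.exp t * Real.exp t) + a / (b - a) ^ 2) * (Real.exp t)⁻¹ := by
        field_simp
      rw [this, h2]
      have : b * (-(a * b) / (b * (b - a)) ^ 2) + a / (b - a) ^ 2 = 0 := by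
        field_simp
        ring
      rw [this, zero_mul]
    rw [h3, zero_div]
  · exact (isBackwardEndpoint_iff.mpr ⟨by rw [m11]; positivity, by rw [m01, m11]; ring⟩).flow t
  · exact (isForwardEndpoint_iff.mpr ⟨by simp [m10], by rw [m00, m10]; ring⟩).flow t

/-- Base point of a geodesic with endpoints `a`, `b` at time `t` after it crosses the imaginary
axis. -/
theorem flow_base_of_endpoints {p : UnitTangent} {a b : ℝ} (h0 : p.base.re = 0)
    (ha : IsBackwardEndpoint p a) (hb : IsForwardEndpoint p b) (t : ℝ) :
    (geodesicFlow t p).base.re * (b - a * Real.exp (2 * t)) = a * b * (1 - Real.exp (2 * t)) ∧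
    ((geodesicFlow t p).base.re ^ 2 + (geodesicFlow t p).base.im ^ 2)
      * (b - a * Real.exp (2 * t)) = a * b * (a - b * Real.exp (2 * t)) := by
  have hab := endpoints_mul_neg h0 ha hb
  obtain ⟨M, rfl⟩ := exists_smul_upVector p
  obtain ⟨h1, h2⟩ := flow_base M t
  rw [isBackwardEndpoint_iff] at ha
  rw [isForwardEndpoint_iff] at hb
  rw [base_re_eq_zero_iff, ha.2, hb.2] at h0
  have hd := det_eq_one M
  rw [ha.2, hb.2] at hd
  rw [h1, h2, ha.2, hb.2]
  have hE : Real.exp (2 * t) = Real.exp t ^ 2 := by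
    rw [← Real.exp_nat_mul]; norm_num
  rw [hE, Real.exp_neg]
  have he := Real.exp_pos t
  set E := Real.exp t
  have hc : 0 < M 1 0 ^ 2 := by have := hb.1; positivity
  have hD : M 1 0 ^ 2 * E + M 1 1 ^ 2 * E⁻¹ = (M 1 0 ^ 2 * E ^ 2 + M 1 1 ^ 2) / E := by
    field_simp
  have hD0 : 0 < M 1 0 ^ 2 * E ^ 2 + M 1 1 ^ 2 := by positivity
  have hx : (b * M 1 0 * M 1 0 * E + a * M 1 1 * M 1 1 * E⁻¹) / (M 1 0 ^ 2 * E + M 1 1 ^ 2 * E⁻¹)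
      = (b * M 1 0 ^ 2 * E ^ 2 + a * M 1 1 ^ 2) / (M 1 0 ^ 2 * E ^ 2 + M 1 1 ^ 2) := by
    rw [hD]
    field_simp
  have hN : ((b * M 1 0 ^ 2 * E ^ 2 + a * M 1 1 ^ 2) / (M 1 0 ^ 2 * E ^ 2 + M 1 1 ^ 2)) ^ 2
      + (1 / ((M 1 0 ^ 2 * E ^ 2 + M 1 1 ^ 2) / E)) ^ 2
      = (b ^ 2 * M 1 0 ^ 2 * E ^ 2 + a ^ 2 * M 1 1 ^ 2) / (M 1 0 ^ 2 * E ^ 2 + M 1 1 ^ 2) := by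
    rw [one_div_div, div_pow, div_pow, ← add_div, div_eq_div_iff (by positivity) hD0.ne']
    -- The determinant relation is needed squared, hence the factor 1 + `M 1 0 * M 1 1 * (b - a)`.
    linear_combination -(M 1 0 ^ 2 * E ^ 2 + M 1 1 ^ 2) * E ^ 2
      * (1 + M 1 0 * M 1 1 * (b - a)) * hd
  rw [hx, hD, hN, div_mul_eq_mul_div, div_mul_eq_mul_div, div_eq_iff hD0.ne', div_eq_iff hD0.ne']
  constructor
  · linear_combination (E ^ 2 * (b - a * E ^ 2) - a * (1 - E ^ 2) * E ^ 2) * h0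
  · linear_combination (b * E ^ 2 * (b - a * E ^ 2) - a * (a - b * E ^ 2) * E ^ 2) * h0

/-! ### The modular group and the Farey tessellation -/

/-- The image of an integral matrix in `SL(2, ℝ)`. -/
def toReal (γ : SL(2, ℤ)) : SL(2, ℝ) := Matrix.SpecialLinearGroup.map (Int.castRingHom ℝ) γ

theorem toReal_smul (γ : SL(2, ℤ)) (p : UnitTangent) : toReal γ • p = γ • p := rfl

theorem toReal_apply (γ : SL(2, ℤ)) (i j : Fin 2) : toReal γ i j = (γ i j : ℝ) := rfl

theorem toModular_eq_iff {p q : UnitTangent} :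
    toModular p = toModular q ↔ ∃ γ : SL(2, ℤ), γ • q = p := by
  unfold toModular
  rw [Quotient.eq]
  exact Iff.rfl

theorem toModular_smul (γ : SL(2, ℤ)) (p : UnitTangent) : toModular (γ • p) = toModular p :=
  toModular_eq_iff.mpr ⟨γ, rfl⟩

theorem det_int_eq_one (γ : SL(2, ℤ)) : γ 0 0 * γ 1 1 - γ 0 1 * γ 1 0 = 1 := by
  have := γ.det_coe
  rwa [Matrix.det_fin_two] at this

/-- The interior of the ideal triangle with vertices `0, 1, ∞` contains no point of an edge of the
Farey tessellation. -/
theorem farey_triangle_interior {a b c d : ℤ} (hdet : a * d - b * c = 1) {x N : ℝ} (hx0 : 0 < x)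
    (hx1 : x < 1) (hN : x < N) : (a * c * N + (a * d + b * c) * x + b * d : ℝ) ≠ 0 := by
  intro h
  -- The coefficients are the values of the form (aX + bY)(cX + dY) at the vertices ∞, 1, 0, and the
  -- weights are positive inside the triangle. So it suffices that the three integers are not all
  -- zero and no two have strictly opposite signs.
  have h1 : ((a * c : ℤ) : ℝ) * (N - x) + (((a + b) * (c + d) : ℤ) : ℝ) * x
      + ((b * d : ℤ) : ℝ) * (1 - x) = 0 := by
    push_cast
    linear_combination h
  set m := b * c with hm
  -- A product of consecutive integers is never negative, so ac and bd do not have opposite signs.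
  have hAB : (a * c) * (b * d) = m * (m + 1) := by
    rw [show a * c * (b * d) = (a * d) * m by rw [hm]; ring, show a * d = m + 1 by linarith]
    ring
  have hC : (a + b) * (c + d) = a * c + b * d + (2 * m + 1) := by linear_combination hdet + 2 * hm
  have hmm : 0 ≤ m * (m + 1) := by
    rcases le_or_gt 0 m with h | h
    · positivity
    · nlinarith
  rw [hC] at h1
  generalize a * c = A at *
  generalize b * d = B at *
  have hNx : 0 < N - x := by linarith
  have h1x : 0 < 1 - x := by linarith
  have hpos (P Q R : ℤ) (hP : 0 ≤ P) (hQ : 0 ≤ Q) (hR : 0 ≤ R)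
      (he : (P : ℝ) * (N - x) + (R : ℝ) * x + (Q : ℝ) * (1 - x) = 0) : P = 0 ∧ Q = 0 ∧ R = 0 := by
    have hP' : (0 : ℝ) ≤ P := by exact_mod_cast hP
    have hQ' : (0 : ℝ) ≤ Q := by exact_mod_cast hQ
    have hR' : (0 : ℝ) ≤ R := by exact_mod_cast hR
    have p1 := mul_nonneg hP' hNx.le
    have p2 := mul_nonneg hQ' h1x.le
    have p3 := mul_nonneg hR' hx0.le
    refine ⟨?_, ?_, ?_⟩
    · have : (P : ℝ) * (N - x) = 0 := by linarith
      simpa [hNx.ne'] using this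
    · have : (Q : ℝ) * (1 - x) = 0 := by linarith
      simpa [h1x.ne'] using this
    · have : (R : ℝ) * x = 0 := by linarith
      simpa [hx0.ne'] using this
  -- In this case A = B = 0 and the middle coefficient is the odd number 2m + 1.
  by_cases h0 : A + B = 0
  · have hB : B = -A := by linarith
    have hA : A = 0 := by
      rw [hB] at hAB
      nlinarith
    have hB : B = 0 := by linarith
    simp only [hA, hB, Int.cast_zero, zero_mul, zero_add, add_zero] at h1
    have : ((2 * m + 1 : ℤ) : ℝ) = 0 := by simpa [hx0.ne'] using h1
    have : 2 * m + 1 = 0 := by exact_mod_cast this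
    omega
  rcases lt_or_gt_of_ne h0 with h0 | h0
  · have hA : A ≤ 0 := by by_contra! hh; nlinarith
    have hB : B ≤ 0 := by by_contra! hh; nlinarith
    -- (2m + 1)² = 4AB + 1 ≤ (A + B)² + 1, so by integrality |2m + 1| ≤ |A + B| and the middle
    -- coefficient follows the sign of A + B.
    have hR : A + B + (2 * m + 1) ≤ 0 := by
      by_contra! hh
      nlinarith [sq_nonneg (A - B)]
    have := hpos (-A) (-B) (-(A + B + (2 * m + 1))) (by linarith) (by linarith) (by linarith)
      (by push_cast at h1 ⊢; linarith)
    omega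
  · have hA : 0 ≤ A := by by_contra! hh; nlinarith
    have hB : 0 ≤ B := by by_contra! hh; nlinarith
    have hR : 0 ≤ A + B + (2 * m + 1) := by
      by_contra! hh
      nlinarith [sq_nonneg (A - B)]
    have := hpos A B (A + B + (2 * m + 1)) hA hB hR h1
    omega

/-- An element of the modular group that moves a point of the imaginary axis to a point of the
imaginary axis fixes the axis. -/
theorem stabilizer_imaginary_axis {γ : SL(2, ℤ)} {z : ℍ} (hz : z.re = 0)
    (h : (toReal γ • z).re = 0) :
    γ = 1 ∨ γ = -1 ∨ γ = ModularGroup.S ∨ γ = -ModularGroup.S := by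
  rw [re_smul_eq_zero_iff, hz] at h
  simp only [toReal_apply] at h
  have hdet := det_int_eq_one γ
  have hy := z.im_pos
  set a := γ 0 0 with ha
  set b := γ 0 1 with hb
  set c := γ 1 0 with hc
  set d := γ 1 1 with hd
  have h1 : ((a * c : ℤ) : ℝ) * z.im ^ 2 + ((b * d : ℤ) : ℝ) = 0 := by push_cast; linarith
  -- Again a product of consecutive integers: ac and bd cannot cancel in `h1` unless both vanish,
  -- and then the matrix is diagonal or antidiagonal.
  have hm : (a * c) * (b * d) = (b * c) * (b * c + 1) := by
    rw [show b * c + 1 = a * d by linarith]; ring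
  have hmm : 0 ≤ (b * c) * (b * c + 1) := by
    rcases le_or_gt 0 (b * c) with h | h
    · positivity
    · nlinarith
  have hac : a * c = 0 := by
    have h2 : (0 : ℝ) ≤ ((a * c : ℤ) : ℝ) * ((b * d : ℤ) : ℝ) := by
      rw [← Int.cast_mul, hm]; exact_mod_cast hmm
    have h3 : ((a * c : ℤ) : ℝ) ^ 2 * z.im ^ 2 = 0 := by
      have e : ((a * c : ℤ) : ℝ) ^ 2 * z.im ^ 2 = -(((a * c : ℤ) : ℝ) * ((b * d : ℤ) : ℝ)) := by
        linear_combination ((a * c : ℤ) : ℝ) * h1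
      have : 0 ≤ ((a * c : ℤ) : ℝ) ^ 2 * z.im ^ 2 := by positivity
      linarith
    have h4 : ((a * c : ℤ) : ℝ) = 0 := by simpa [hy.ne'] using h3
    exact_mod_cast h4
  have hbd : b * d = 0 := by
    rw [hac] at h1
    have : ((b * d : ℤ) : ℝ) = 0 := by simpa using h1
    exact_mod_cast this
  rcases mul_eq_zero.mp hac with h0 | h0
  · have hbc : b * -c = 1 := by rw [h0] at hdet; linarith
    have hb0 : b ≠ 0 := by intro h; simp [h] at hbc
    have hd0 : d = 0 := (mul_eq_zero.mp hbd).resolve_left hb0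
    rcases Int.mul_eq_one_iff_eq_one_or_neg_one.mp hbc with ⟨e1, e2⟩ | ⟨e1, e2⟩
    · right; right; right
      have e3 : c = -1 := by omega
      ext i j
      rw [Matrix.SpecialLinearGroup.coe_neg, ModularGroup.coe_S]
      fin_cases i <;> fin_cases j <;> simp [← ha, ← hb, ← hc, ← hd, h0, hd0, e1, e3]
    · right; right; left
      have e3 : c = 1 := by omega
      ext i j
      rw [ModularGroup.coe_S]
      fin_cases i <;> fin_cases j <;> simp [← ha, ← hb, ← hc, ← hd, h0, hd0, e1, e3]
  · have had : a * d = 1 := by rw [h0] at hdet; linarith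
    have hd0 : d ≠ 0 := by intro h; simp [h] at had
    have hb0 : b = 0 := (mul_eq_zero.mp hbd).resolve_right hd0
    rcases Int.mul_eq_one_iff_eq_one_or_neg_one.mp had with ⟨e1, e2⟩ | ⟨e1, e2⟩
    · left
      ext i j
      fin_cases i <;> fin_cases j <;> simp [← ha, ← hb, ← hc, ← hd, h0, hb0, e1, e2]
    · right; left
      ext i j
      fin_cases i <;> fin_cases j <;> simp [← ha, ← hb, ← hc, ← hd, h0, hb0, e1, e2]

theorem neg_smul_int (γ : SL(2, ℤ)) (p : UnitTangent) : (-γ) • p = γ • p := by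
  rw [← toReal_smul, ← toReal_smul, ← neg_smul_tangent (toReal γ)]
  congr 1
  ext i j
  simp [toReal_apply]

/-! ### Inversion and translations acting on endpoints -/

theorem toReal_S_apply : toReal ModularGroup.S 0 0 = 0 ∧ toReal ModularGroup.S 0 1 = -1 ∧
    toReal ModularGroup.S 1 0 = 1 ∧ toReal ModularGroup.S 1 1 = 0 := by
  simp only [toReal_apply, ModularGroup.coe_S]
  simp

theorem S_smul_base_re {p : UnitTangent} (h : p.base.re = 0) :
    (ModularGroup.S • p).base.re = 0 := by
  obtain ⟨e1, e2, e3, e4⟩ := toReal_S_apply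
  rw [← toReal_smul, base_smul, re_smul_eq_zero_iff, h, e1, e2, e3, e4]
  simp

theorem IsForwardEndpoint.S_smul {p : UnitTangent} {b : ℝ} (hb : IsForwardEndpoint p b)
    (h : b ≠ 0) : IsForwardEndpoint (ModularGroup.S • p) (-b⁻¹) := by
  obtain ⟨e1, e2, e3, e4⟩ := toReal_S_apply
  have := hb.smul (toReal ModularGroup.S) (by rw [e3, e4]; simpa using h)
  rw [toReal_smul, e1, e2, e3, e4] at this
  simpa only [zero_mul, zero_add, one_mul, add_zero, neg_div, one_div] using this

theorem IsBackwardEndpoint.S_smul {p : UnitTangent} {a : ℝ} (ha : IsBackwardEndpoint p a)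
    (h : a ≠ 0) : IsBackwardEndpoint (ModularGroup.S • p) (-a⁻¹) := by
  obtain ⟨e1, e2, e3, e4⟩ := toReal_S_apply
  have := ha.smul (toReal ModularGroup.S) (by rw [e3, e4]; simpa using h)
  rw [toReal_smul, e1, e2, e3, e4] at this
  simpa only [zero_mul, zero_add, one_mul, add_zero, neg_div, one_div] using this

/-- The matrix of the translation `z ↦ z + n`. -/
def translation (n : ℤ) : SL(2, ℤ) := ⟨!![1, n; 0, 1], by simp⟩

theorem translation_apply (n : ℤ) : toReal (translation n) 0 0 = 1 ∧
    toReal (translation n) 0 1 = n ∧ toReal (translation n) 1 0 = 0 ∧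
    toReal (translation n) 1 1 = 1 := by
  have h : (translation n).1 = !![1, n; 0, 1] := rfl
  simp only [toReal_apply, h]
  simp

theorem translation_smul_base_re (n : ℤ) (p : UnitTangent) :
    (translation n • p).base.re = p.base.re + n := by
  obtain ⟨e1, e2, e3, e4⟩ := translation_apply n
  rw [← toReal_smul, base_smul, re_smul, e1, e2, e3, e4]
  simp

theorem IsForwardEndpoint.translation_smul {p : UnitTangent} {b : ℝ} (hb : IsForwardEndpoint p b)
    (n : ℤ) : IsForwardEndpoint (translation n • p) (b + n) := by
  obtain ⟨e1, e2, e3, e4⟩ := translation_apply n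
  have := hb.smul (toReal (translation n)) (by rw [e3, e4]; simp)
  rw [toReal_smul, e1, e2, e3, e4] at this
  simpa using this

theorem IsBackwardEndpoint.translation_smul {p : UnitTangent} {a : ℝ} (ha : IsBackwardEndpoint p a)
    (n : ℤ) : IsBackwardEndpoint (translation n • p) (a + n) := by
  obtain ⟨e1, e2, e3, e4⟩ := translation_apply n
  have := ha.smul (toReal (translation n)) (by rw [e3, e4]; simp)
  rw [toReal_smul, e1, e2, e3, e4] at this
  simpa using this

theorem IsForwardEndpoint.unique {p : UnitTangent} {b b' : ℝ} (h : IsForwardEndpoint p b)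
    (h' : IsForwardEndpoint p b') : b = b' :=
  Complex.ofReal_inj.mp (tendsto_nhds_unique h h')

theorem IsBackwardEndpoint.unique {p : UnitTangent} {a a' : ℝ} (h : IsBackwardEndpoint p a)
    (h' : IsBackwardEndpoint p a') : a = a' :=
  Complex.ofReal_inj.mp (tendsto_nhds_unique h h')

/-! ### The cross section and its coordinates -/

/-- Nonvertical means that both endpoints are real, and opposite signs make them nonzero. If |β| ≤
1, the lift moved by S has forward endpoint -1/β. -/
theorem crossSection_eq :
    crossSection = {x | ∃ p, toModular p = x ∧ p.base.re = 0 ∧ p.vec.re ≠ 0} := by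
  ext x
  constructor
  · rintro ⟨p, a, b, rfl, h⟩
    refine ⟨p, rfl, h.re_base, ?_⟩
    obtain ⟨M, rfl⟩ := exists_smul_upVector p
    exact vec_re_ne_zero_iff.mpr ⟨(isForwardEndpoint_iff.mp h.forward).1,
      (isBackwardEndpoint_iff.mp h.backward).1⟩
  · rintro ⟨p, rfl, h0, hv⟩
    obtain ⟨a, b, ha, hb⟩ : ∃ a b, IsBackwardEndpoint p a ∧ IsForwardEndpoint p b := by
      obtain ⟨M, rfl⟩ := exists_smul_upVector p
      obtain ⟨hc, hd⟩ := vec_re_ne_zero_iff.mp hv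
      exact ⟨_, _, isBackwardEndpoint_smul_upVector hd, isForwardEndpoint_smul_upVector hc⟩
    have hab := endpoints_mul_neg h0 ha hb
    have ha0 : a ≠ 0 := by rintro rfl; simp at hab
    have hb0 : b ≠ 0 := by rintro rfl; simp at hab
    rcases le_total 1 |b| with h1 | h1
    · exact ⟨p, a, b, rfl, h0, ha, hb, ha0, h1⟩
    · refine ⟨ModularGroup.S • p, _, _, toModular_smul _ _, S_smul_base_re h0, ha.S_smul ha0,
        hb.S_smul hb0, by simpa using ha0, ?_⟩
      rw [abs_neg, abs_inv]
      exact (one_le_inv₀ (abs_pos.mpr hb0)).mpr h1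

/-- In terms of coordinates, the endpoints are `-ε (1 / W - 1)` and `ε / U`. -/
theorem hasCoordinates_iff {x : ModularTangent} {U W : ℝ} {ε : ℤˣ} :
    HasCoordinates x U W ε ↔ (U ∈ Ioc (0 : ℝ) 1 ∧ W ∈ Ioo (0 : ℝ) 1) ∧ ∃ p, toModular p = x ∧
      p.base.re = 0 ∧ IsBackwardEndpoint p (-(ε : ℤ) * (W⁻¹ - 1)) ∧
      IsForwardEndpoint p ((ε : ℤ) * U⁻¹) := by
  constructor
  · rintro ⟨p, a, b, rfl, h, rfl, rfl, hε⟩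
    have hab := endpoints_mul_neg h.re_base h.backward h.forward
    have ha := abs_pos.mpr h.backward_ne_zero
    have hb := h.one_le_abs_forward
    refine ⟨⟨⟨by positivity, inv_le_one_of_one_le₀ hb⟩, by positivity,
      inv_lt_one_of_one_lt₀ (by linarith)⟩, p, rfl, h.re_base, ?_⟩
    rw [inv_inv, inv_inv, add_sub_cancel_left, hε]
    -- Since the endpoints have opposite signs, ε fixes the sign of α too.
    rcases lt_trichotomy b 0 with h0 | h0 | h0
    · have h1 : 0 < a := by nlinarith
      rw [Real.sign_of_neg h0, abs_of_neg h0, abs_of_pos h1]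
      simpa using ⟨h.backward, h.forward⟩
    · simp [h0] at hab
    · have h1 : a < 0 := by nlinarith
      rw [Real.sign_of_pos h0, abs_of_pos h0, abs_of_neg h1]
      simpa using ⟨h.backward, h.forward⟩
  · rintro ⟨⟨⟨hU0, hU1⟩, hW0, hW1⟩, p, rfl, h0, ha, hb⟩
    have hW : 0 < W⁻¹ - 1 := by have := (one_lt_inv₀ hW0).mpr hW1; linarith
    have hε : |((ε : ℤ) : ℝ)| = 1 := by
      rcases Int.units_eq_one_or ε with rfl | rfl <;> simp
    refine ⟨p, _, _, rfl, ⟨h0, ha, hb, ?_, ?_⟩, ?_, ?_, ?_⟩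
    · rw [← abs_pos, abs_mul, abs_neg, hε, one_mul]; positivity
    · rw [abs_mul, hε, one_mul, abs_inv, abs_of_pos hU0]
      exact (one_le_inv₀ hU0).mpr hU1
    · rw [abs_mul, hε, one_mul, abs_inv, abs_of_pos hU0, inv_inv]
    · rw [abs_mul, abs_neg, hε, one_mul, abs_of_pos hW, add_sub_cancel, inv_inv]
    · rcases Int.units_eq_one_or ε with rfl | rfl
      · simp [Real.sign_of_pos (inv_pos.mpr hU0)]
      · simp [Real.sign_of_neg (neg_lt_zero.mpr (inv_pos.mpr hU0))]

theorem HasCoordinates.mem_crossSection {x : ModularTangent} {U W : ℝ} {ε : ℤˣ}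
    (h : HasCoordinates x U W ε) : x ∈ crossSection := by
  obtain ⟨p, a, b, h1, h2, -⟩ := h
  exact ⟨p, a, b, h1, h2⟩

theorem exists_hasCoordinates {x : ModularTangent} (hx : x ∈ crossSection) :
    ∃ U W ε, HasCoordinates x U W ε := by
  obtain ⟨p, a, b, rfl, h⟩ := hx
  have hb : b ≠ 0 := by
    rintro rfl
    have := h.one_le_abs_forward
    norm_num at this
  rcases lt_or_gt_of_ne hb with h0 | h0
  · exact ⟨_, _, -1, p, a, b, rfl, h, rfl, rfl, by simp [Real.sign_of_neg h0]⟩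
  · exact ⟨_, _, 1, p, a, b, rfl, h, rfl, rfl, by simp [Real.sign_of_pos h0]⟩

theorem existsUnique_hasCoordinates {U W : ℝ} (hU : U ∈ Ioc (0 : ℝ) 1) (hW : W ∈ Ioo (0 : ℝ) 1)
    (ε : ℤˣ) : ∃! x, HasCoordinates x U W ε := by
  have hW' : 0 < W⁻¹ - 1 := by have := (one_lt_inv₀ hW.1).mpr hW.2; linarith
  have hU' : 0 < U⁻¹ := inv_pos.mpr hU.1
  obtain ⟨p, h0, ha, hb⟩ := exists_endpoints (a := -(ε : ℤ) * (W⁻¹ - 1)) (b := (ε : ℤ) * U⁻¹) (by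
    have := mul_pos hW' hU'
    rcases Int.units_eq_one_or ε with rfl | rfl <;> simp <;> linarith)
  refine ⟨toModular p, hasCoordinates_iff.mpr ⟨⟨hU, hW⟩, p, rfl, h0, ha, hb⟩, ?_⟩
  intro y hy
  obtain ⟨-, q, rfl, q0, qa, qb⟩ := hasCoordinates_iff.mp hy
  rw [eq_of_endpoints q0 h0 qa qb ha hb]

/-- S sends β = ε to -ε and inverts |α| = (1 - W)/W, which exchanges W and 1 - W. -/
theorem HasCoordinates.flip {x : ModularTangent} {W : ℝ} {ε : ℤˣ} (h : HasCoordinates x 1 W ε) :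
    HasCoordinates x 1 (1 - W) (-ε) := by
  obtain ⟨⟨hU, hW0, hW1⟩, p, rfl, h0, ha, hb⟩ := hasCoordinates_iff.mp h
  have hW' : 0 < W⁻¹ - 1 := by have := (one_lt_inv₀ hW0).mpr hW1; linarith
  have hW2 : 1 - W ≠ 0 := by linarith
  refine hasCoordinates_iff.mpr ⟨⟨hU, by linarith, by linarith⟩, ModularGroup.S • p,
    toModular_smul _ _, S_smul_base_re h0, ?_, ?_⟩
  · have := ha.S_smul (by simp [hW'.ne'])
    have e1 : W⁻¹ - 1 = (1 - W) / W := by field_simp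
    have e2 : (1 - W)⁻¹ - 1 = W / (1 - W) := by field_simp; ring
    convert this using 1
    rw [e1, e2]
    rcases Int.units_eq_one_or ε with rfl | rfl <;> simp
  · have := hb.S_smul (by simp)
    convert this using 1
    rcases Int.units_eq_one_or ε with rfl | rfl <;> simp

/-- Two lifts on the axis differ by ±1, which changes nothing, or by ±S, which inverts |β|; both
lifts having |β| ≥ 1 then forces |β| = 1. -/
theorem hasCoordinates_unique {x : ModularTangent} {U W : ℝ} {ε : ℤˣ} (h : HasCoordinates x U W ε)
    {U' W' : ℝ} {ε' : ℤˣ} (h' : HasCoordinates x U' W' ε') :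
    (U' = U ∧ W' = W ∧ ε' = ε) ∨ (U = 1 ∧ U' = 1 ∧ W' = 1 - W ∧ ε' = -ε) := by
  obtain ⟨p, a, b, rfl, h1, rfl, rfl, hε⟩ := h
  obtain ⟨q, a', b', hq, h2, rfl, rfl, hε'⟩ := h'
  obtain ⟨γ, rfl⟩ := toModular_eq_iff.mp hq
  have hb : b ≠ 0 := by
    rintro rfl
    have := h1.one_le_abs_forward
    norm_num at this
  have hγ := stabilizer_imaginary_axis h1.re_base (γ := γ) h2.re_base
  have hcast {e e' : ℤˣ} (h : ((e : ℤ) : ℝ) = ((e' : ℤ) : ℝ)) : e = e' := by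
    exact Units.ext (by exact_mod_cast h)
  have hsame (hs : γ • p = p) : |b'|⁻¹ = |b|⁻¹ ∧ (1 + |a'|)⁻¹ = (1 + |a|)⁻¹ ∧ ε' = ε := by
    rw [hs] at h2
    obtain rfl := h1.forward.unique h2.forward
    obtain rfl := h1.backward.unique h2.backward
    exact ⟨rfl, rfl, hcast (hε'.trans hε.symm)⟩
  have hflip (hs : γ • p = ModularGroup.S • p) :
      |b|⁻¹ = 1 ∧ |b'|⁻¹ = 1 ∧ (1 + |a'|)⁻¹ = 1 - (1 + |a|)⁻¹ ∧ ε' = -ε := by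
    rw [hs] at h2
    obtain rfl := (h1.forward.S_smul hb).unique h2.forward
    obtain rfl := (h1.backward.S_smul h1.backward_ne_zero).unique h2.backward
    have hb1 := h1.one_le_abs_forward
    have hb2 := h2.one_le_abs_forward
    rw [abs_neg, abs_inv] at hb2
    have hbb : |b| = 1 := le_antisymm ((one_le_inv₀ (abs_pos.mpr hb)).mp hb2) hb1
    have ha := abs_pos.mpr h1.backward_ne_zero
    refine ⟨by simp [hbb], by simp [hbb], ?_, hcast ?_⟩
    · rw [abs_neg, abs_inv]
      field_simp
      ring
    · rw [hε']
      push_cast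
      rw [hε]
      rcases lt_or_gt_of_ne hb with h0 | h0
      · rw [Real.sign_of_neg h0, Real.sign_of_pos (neg_pos.mpr (inv_lt_zero.mpr h0))]; simp
      · rw [Real.sign_of_pos h0, Real.sign_of_neg (neg_lt_zero.mpr (inv_pos.mpr h0))]
  rcases hγ with rfl | rfl | rfl | rfl
  · exact Or.inl (hsame (one_smul _ _))
  · exact Or.inl (hsame (by rw [neg_smul_int, one_smul]))
  · exact Or.inr (hflip rfl)
  · exact Or.inr (hflip (neg_smul_int _ _))

/-! ### The first return -/

theorem base_re_smul_eq_zero_of_mem {p : UnitTangent} (h : toModular p ∈ crossSection) :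
    ∃ γ : SL(2, ℤ), (toReal γ • p.base).re = 0 := by
  obtain ⟨q, a, b, hq, h1⟩ := h
  obtain ⟨γ, rfl⟩ := toModular_eq_iff.mp hq
  exact ⟨γ, h1.re_base⟩

/-- A Farey edge does not meet the interiors of the ideal triangles with vertices `0, ε, ∞`. -/
theorem farey_triangle_interior_sign (ε : ℤˣ) (γ : SL(2, ℤ)) (z : ℍ) (h0 : 0 < (ε : ℤ) * z.re)
    (h1 : (ε : ℤ) * z.re < 1) (h2 : (ε : ℤ) * z.re < z.re ^ 2 + z.im ^ 2) :
    (toReal γ • z).re ≠ 0 := by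
  rw [Ne, re_smul_eq_zero_iff]
  simp only [toReal_apply]
  have hd := det_int_eq_one γ
  rcases Int.units_eq_one_or ε with rfl | rfl
  · simp only [Units.val_one, Int.cast_one, one_mul] at h0 h1 h2
    exact farey_triangle_interior hd h0 h1 h2
  · simp only [Units.val_neg, Units.val_one, Int.cast_neg, Int.cast_one, neg_mul, one_mul]
      at h0 h1 h2
    -- Reflection in the imaginary axis conjugates γ by diag(1, -1), which negates the off-diagonal
    -- entries.
    have := farey_triangle_interior (a := γ 0 0) (b := -γ 0 1) (c := -γ 1 0) (d := γ 1 1)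
      (by linarith) h0 h1 h2
    intro h
    apply this
    push_cast
    linear_combination -h

/-- The geodesic flow does not return to the cross section before the time
`-log ((1 - U) (1 - W)) / 2`, and never if `U = 1`. -/
theorem not_mem_crossSection {p : UnitTangent} {U W s : ℝ} {ε : ℤˣ} (hU : U ∈ Ioc (0 : ℝ) 1)
    (hW : W ∈ Ioo (0 : ℝ) 1) (h0 : p.base.re = 0)
    (ha : IsBackwardEndpoint p (-(ε : ℤ) * (W⁻¹ - 1))) (hb : IsForwardEndpoint p ((ε : ℤ) * U⁻¹))
    (hs : 0 < s) (hE : Real.exp (2 * s) * ((1 - U) * (1 - W)) < 1) :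
    toModular (geodesicFlow s p) ∉ crossSection := by
  intro hmem
  obtain ⟨γ, hγ⟩ := base_re_smul_eq_zero_of_mem hmem
  obtain ⟨f1, f2⟩ := flow_base_of_endpoints h0 ha hb s
  have hE1 : 1 < Real.exp (2 * s) := Real.one_lt_exp_iff.mpr (by linarith)
  set E := Real.exp (2 * s)
  set z := (geodesicFlow s p).base
  have hA : 0 < W⁻¹ - 1 := by have := (one_lt_inv₀ hW.1).mpr hW.2; linarith
  have hB : 1 ≤ U⁻¹ := (one_le_inv₀ hU.1).mpr hU.2
  -- In terms of A = |α| and B = |β| this says that the geodesic has not reached the line Re z = ε.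
  have hE' : (W⁻¹ - 1) * (U⁻¹ - 1) * E < U⁻¹ * (1 + (W⁻¹ - 1)) := by
    have hUW : 0 < U⁻¹ * W⁻¹ := mul_pos (inv_pos.mpr hU.1) (inv_pos.mpr hW.1)
    have := mul_lt_mul_of_pos_left hE hUW
    have e : (W⁻¹ - 1) * (U⁻¹ - 1) * E = U⁻¹ * W⁻¹ * (E * ((1 - U) * (1 - W))) := by
      have := hU.1.ne'
      have := hW.1.ne'
      field_simp
    rw [e]
    linarith
  have hε : ((ε : ℤ) : ℝ) * ((ε : ℤ) : ℝ) = 1 := by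
    rcases Int.units_eq_one_or ε with rfl | rfl <;> simp
  generalize hAdef : W⁻¹ - 1 = A at *
  generalize hBdef : U⁻¹ = B at *
  generalize hedef : ((ε : ℤ) : ℝ) = e at *
  have g1 : (e * z.re) * (B + A * E) = A * B * (E - 1) := by
    linear_combination f1 + A * B * (E - 1) * hε
  have g2 : (z.re ^ 2 + z.im ^ 2) * (B + A * E) = A * B * (A + B * E) := by
    linear_combination e * f2 + ((A * B * (A + B * E)) * (e ^ 2 + 1)
      - (z.re ^ 2 + z.im ^ 2) * (B + A * E)) * hε
  have hD : 0 < B + A * E := by positivity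
  have hAB : 0 < A * B := by positivity
  refine farey_triangle_interior_sign ε γ z ?_ ?_ ?_ hγ <;> rw [hedef]
  · refine pos_of_mul_pos_left ?_ hD.le
    rw [g1]
    exact mul_pos hAB (by linarith)
  · refine lt_of_mul_lt_mul_right ?_ hD.le
    rw [g1]
    nlinarith
  · refine lt_of_mul_lt_mul_right ?_ hD.le
    rw [g1, g2]
    -- What remains is E - 1 < A + BE, true because B ≥ 1: the geodesic stays above the edge from 0
    -- to ε.
    refine mul_lt_mul_of_pos_left ?_ hAB
    nlinarith

theorem exp_two_mul_return {U W : ℝ} (hU : U < 1) (hW : W < 1) :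
    Real.exp (2 * (-(1 / 2) * Real.log ((1 - U) * (1 - W)))) * ((1 - U) * (1 - W)) = 1 := by
  have h : 0 < (1 - U) * (1 - W) := mul_pos (by linarith) (by linarith)
  rw [show 2 * (-(1 / 2) * Real.log ((1 - U) * (1 - W))) = -Real.log ((1 - U) * (1 - W)) by ring,
    Real.exp_neg, Real.exp_log h, inv_mul_cancel₀ h.ne']

/-- At this time the geodesic crosses Re z = ε, which translation by -ε carries to the imaginary
axis. The branch is decided by whether the translated |β| = (1 - U)/U is still at least 1 or S is
needed to restore this. -/
theorem HasCoordinates.flow_return {x : ModularTangent} {U W : ℝ} {ε : ℤˣ}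
    (h : HasCoordinates x U W ε) (hU : U < 1) :
    HasCoordinates (modularFlow (-(1 / 2) * Real.log ((1 - U) * (1 - W))) x)
      (fareyExtension (U, W)).1 (fareyExtension (U, W)).2 (if U ≤ 1 / 2 then ε else -ε) := by
  obtain ⟨⟨⟨hU0, -⟩, hW0, hW1⟩, p, rfl, h0, ha, hb⟩ := hasCoordinates_iff.mp h
  have hE := exp_two_mul_return hU hW1
  set s := -(1 / 2) * Real.log ((1 - U) * (1 - W))
  have hε : ((ε : ℤ) : ℝ) * ((ε : ℤ) : ℝ) = 1 := by
    rcases Int.units_eq_one_or ε with rfl | rfl <;> simp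
  have hre : (geodesicFlow s p).base.re = (ε : ℤ) := by
    obtain ⟨f1, -⟩ := flow_base_of_endpoints h0 ha hb s
    have hEpos := Real.exp_pos (2 * s)
    set E := Real.exp (2 * s)
    set e := ((ε : ℤ) : ℝ)
    set z := (geodesicFlow s p).base
    have hA : 0 < W⁻¹ - 1 := by have := (one_lt_inv₀ hW0).mpr hW1; linarith
    have hB : 0 < U⁻¹ := inv_pos.mpr hU0
    have hE' : (W⁻¹ - 1) * (U⁻¹ - 1) * E = U⁻¹ * (1 + (W⁻¹ - 1)) := by
      have e : (W⁻¹ - 1) * (U⁻¹ - 1) * E = U⁻¹ * W⁻¹ * (E * ((1 - U) * (1 - W))) := by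
        field_simp
      rw [e, hE]
      ring
    have hD : 0 < U⁻¹ + (W⁻¹ - 1) * E := by positivity
    refine mul_right_cancel₀ hD.ne' ?_
    linear_combination e * f1 + e * hE' + (e * (W⁻¹ - 1) * U⁻¹ * (E - 1)
      - z.re * (U⁻¹ + (W⁻¹ - 1) * E)) * hε
  set q := translation (-(ε : ℤ)) • geodesicFlow s p with hq
  have q0 : q.base.re = 0 := by
    rw [hq, translation_smul_base_re, hre]; simp
  have qa := (ha.flow s).translation_smul (-(ε : ℤ))
  have qb := (hb.flow s).translation_smul (-(ε : ℤ))
  rw [← hq] at qa qb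
  have hqx : toModular q = modularFlow s (toModular p) := toModular_smul _ _
  rw [← hqx]
  by_cases hU2 : U ≤ 1 / 2
  · simp only [fareyExtension, if_pos hU2]
    refine hasCoordinates_iff.mpr ⟨⟨⟨by apply div_pos <;> linarith, ?_⟩, by positivity, ?_⟩,
      q, rfl, q0, ?_, ?_⟩
    · rw [div_le_one (by linarith)]; linarith
    · rw [div_lt_one (by linarith)]; linarith
    · convert qa using 1
      push_cast
      field_simp
      ring
    · convert qb using 1
      push_cast
      field_simp
      ring
  · simp only [fareyExtension, if_neg hU2]
    push Not at hU2
    have hA : 0 < W⁻¹ - 1 := by have := (one_lt_inv₀ hW0).mpr hW1; linarith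
    have ea : -((ε : ℤ) : ℝ) * (W⁻¹ - 1) + (-(ε : ℤ) : ℤ) = -((ε : ℤ) : ℝ) * W⁻¹ := by
      push_cast; ring
    have eb : ((ε : ℤ) : ℝ) * U⁻¹ + (-(ε : ℤ) : ℤ) = ((ε : ℤ) : ℝ) * ((1 - U) / U) := by
      push_cast; field_simp; ring
    rw [ea] at qa
    rw [eb] at qb
    have hε0 : ((ε : ℤ) : ℝ) ≠ 0 := by intro h; simp [h] at hε
    have h1U : (1 - U) / U ≠ 0 := div_ne_zero (by linarith) hU0.ne'
    have hinv : ((ε : ℤ) : ℝ)⁻¹ = (ε : ℤ) := inv_eq_of_mul_eq_one_left hε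
    refine hasCoordinates_iff.mpr ⟨⟨⟨by apply div_pos <;> linarith, ?_⟩, by positivity, ?_⟩,
      ModularGroup.S • q, toModular_smul _ _, S_smul_base_re q0, ?_, ?_⟩
    · rw [div_le_one (by linarith)]; linarith
    · rw [div_lt_one (by linarith)]; linarith
    · convert qa.S_smul (mul_ne_zero (neg_ne_zero.mpr hε0) (by positivity)) using 1
      rw [mul_inv, inv_neg, hinv]
      push_cast
      simp
    · convert qb.S_smul (mul_ne_zero hε0 h1U) using 1
      rw [mul_inv, hinv]
      push_cast
      ring

/-- The geodesic runs into the vertex ε of the triangle that it enters and never leaves the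
interior. -/
theorem HasCoordinates.returnTimes_eq_empty {x : ModularTangent} {W : ℝ} {ε : ℤˣ}
    (h : HasCoordinates x 1 W ε) : returnTimes x = ∅ := by
  obtain ⟨⟨hU, hW⟩, p, rfl, h0, ha, hb⟩ := hasCoordinates_iff.mp h
  rw [Set.eq_empty_iff_forall_notMem]
  rintro s ⟨hs, hmem⟩
  exact not_mem_crossSection hU hW h0 ha hb hs (by simp) hmem

theorem HasCoordinates.isLeast_returnTimes {x : ModularTangent} {U W : ℝ} {ε : ℤˣ}
    (h : HasCoordinates x U W ε) (hU1 : U < 1) :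
    IsLeast (returnTimes x) (-(1 / 2) * Real.log ((1 - U) * (1 - W))) := by
  refine ⟨⟨?_, (h.flow_return hU1).mem_crossSection⟩, ?_⟩
  · obtain ⟨⟨⟨hU0, -⟩, hW0, hW1⟩, -⟩ := hasCoordinates_iff.mp h
    have := Real.log_neg (x := (1 - U) * (1 - W)) (mul_pos (by linarith) (by linarith))
      (by nlinarith)
    linarith
  · rintro s ⟨hs, hmem⟩
    obtain ⟨⟨hU, hW⟩, p, rfl, h0, ha, hb⟩ := hasCoordinates_iff.mp h
    by_contra! hlt
    refine not_mem_crossSection hU hW h0 ha hb hs ?_ hmem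
    refine lt_of_lt_of_eq ?_ (exp_two_mul_return hU1 hW.2)
    refine mul_lt_mul_of_pos_right ?_ (mul_pos (sub_pos.mpr hU1) (sub_pos.mpr hW.2))
    exact Real.exp_lt_exp.mpr (by linarith)

theorem HasCoordinates.lt_one_of_mem_returnDomain {x : ModularTangent} {U W : ℝ} {ε : ℤˣ}
    (h : HasCoordinates x U W ε) (hx : x ∈ returnDomain) : U < 1 := by
  obtain ⟨⟨⟨-, hU⟩, -⟩, -⟩ := hasCoordinates_iff.mp h
  refine lt_of_le_of_ne hU ?_
  rintro rfl
  obtain ⟨-, r, hr⟩ := hx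
  rw [h.returnTimes_eq_empty] at hr
  exact hr.1

theorem HasCoordinates.returnMap {x : returnDomain} {U W : ℝ} {ε : ℤˣ}
    (h : HasCoordinates x U W ε) :
    HasCoordinates (returnMap x) (fareyExtension (U, W)).1 (fareyExtension (U, W)).2
      (if U ≤ 1 / 2 then ε else -ε) := by
  have hU := h.lt_one_of_mem_returnDomain x.2
  have ht : returnTime x = _ := (h.isLeast_returnTimes hU).csInf_eq
  change HasCoordinates (modularFlow (returnTime x) x) _ _ _
  rw [ht]
  exact h.flow_return hU

/-! ### The projection and the factor property -/

theorem exists_normalized_coordinates {x : ModularTangent} (hx : x ∈ crossSection) :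
    ∃ U W ε, HasCoordinates x U W ε ∧ (U < 1 ∨ W ≤ 1 / 2) := by
  obtain ⟨U, W, ε, h⟩ := exists_hasCoordinates hx
  have hU := (hasCoordinates_iff.mp h).1.1.2
  rcases hU.lt_or_eq with h1 | rfl
  · exact ⟨U, W, ε, h, Or.inl h1⟩
  · rcases le_total W (1 / 2) with h2 | h2
    · exact ⟨1, W, ε, h, Or.inr h2⟩
    · exact ⟨1, 1 - W, -ε, h.flip, Or.inr (by linarith)⟩

/-- Both triples of a point with U = 1 are normalized only if W = 1/2, and then they differ in ε
alone. This is why ε is absent from the conclusion. -/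
theorem normalized_coordinates_unique {x : ModularTangent} {U W U' W' : ℝ} {ε ε' : ℤˣ}
    (h : HasCoordinates x U W ε) (hn : U < 1 ∨ W ≤ 1 / 2)
    (h' : HasCoordinates x U' W' ε') (hn' : U' < 1 ∨ W' ≤ 1 / 2) : (U, W) = (U', W') := by
  rcases hasCoordinates_unique h h' with ⟨rfl, rfl, -⟩ | ⟨rfl, rfl, rfl, -⟩
  · rfl
  · have h1 := hn.resolve_left (lt_irrefl _)
    have h2 := hn'.resolve_left (lt_irrefl _)
    rw [show 1 - W = W by linarith]

theorem existsUnique_coordinateProjection :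
    ∃! π : crossSection → ℝ × ℝ, IsCoordinateProjection π := by
  choose U W ε h hn using fun x : crossSection => exists_normalized_coordinates x.2
  refine ⟨fun x => (U x, W x), ?_, ?_⟩
  · intro x U' W' ε' h' hn'
    exact normalized_coordinates_unique (h x) (hn x) h' hn'
  · intro π hπ
    funext x
    exact hπ x _ _ _ (h x) (hn x)

theorem IsCoordinateProjection.mem_unitSquare {π : crossSection → ℝ × ℝ}
    (hπ : IsCoordinateProjection π) (x : crossSection) :
    π x ∈ Icc (0 : ℝ) 1 ×ˢ Icc (0 : ℝ) 1 := by
  obtain ⟨U, W, ε, h, hn⟩ := exists_normalized_coordinates x.2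
  rw [hπ x U W ε h hn]
  obtain ⟨⟨hU, hW⟩, -⟩ := hasCoordinates_iff.mp h
  exact ⟨Ioc_subset_Icc_self hU, Ioo_subset_Icc_self hW⟩

theorem IsCoordinateProjection.semiconj {π : crossSection → ℝ × ℝ}
    (hπ : IsCoordinateProjection π) (x : returnDomain) :
    π (ModularFarey.returnMap x) = fareyExtension (π ⟨x, x.2.1⟩) := by
  obtain ⟨U, W, ε, h, hn⟩ := exists_normalized_coordinates x.2.1
  obtain ⟨⟨⟨hU0, -⟩, hW0, hW1⟩, -⟩ := hasCoordinates_iff.mp h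
  rw [hπ ⟨x, x.2.1⟩ U W ε h hn]
  -- The image triple is again normalized: the first branch has W/(1 + W) ≤ 1/2, the second (1 -
  -- U)/U < 1. A return to U = 1 comes only from U = 1/2, which lies in the first branch, so the
  -- convention W ≤ 1/2 is the right one.
  have hF : (fareyExtension (U, W)).1 < 1 ∨ (fareyExtension (U, W)).2 ≤ 1 / 2 := by
    by_cases hU2 : U ≤ 1 / 2
    · right
      simp only [fareyExtension, if_pos hU2]
      rw [div_le_iff₀ (by linarith)]
      linarith
    · left
      simp only [fareyExtension, if_neg hU2]
      rw [div_lt_one hU0]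
      linarith
  exact hπ _ _ _ _ h.returnMap hF

end ModularFarey

theorem theorem2 :
    -- the cross section consists of the nonvertical vectors based on the positive imaginary axis
    crossSection = {x | ∃ p, toModular p = x ∧ p.base.re = 0 ∧ p.vec.re ≠ 0} ∧
    -- `(U, W, ε)` are coordinates on it, unique up to the identification at `U = 1`
    (∀ x ∈ crossSection, ∃ U ∈ Ioc (0 : ℝ) 1, ∃ W ∈ Ioo (0 : ℝ) 1, ∃ ε, HasCoordinates x U W ε) ∧
    (∀ U ∈ Ioc (0 : ℝ) 1, ∀ W ∈ Ioo (0 : ℝ) 1, ∀ ε, ∃! x, HasCoordinates x U W ε) ∧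
    (∀ x U W ε, HasCoordinates x U W ε → ∀ U' W' ε',
      (HasCoordinates x U' W' ε' ↔
        (U' = U ∧ W' = W ∧ ε' = ε) ∨ (U = 1 ∧ U' = 1 ∧ W' = 1 - W ∧ ε' = -ε))) ∧
    -- the return map is defined exactly at the points with `U < 1`
    (∀ x, x ∈ returnDomain ↔
      ∃ U ∈ Ioo (0 : ℝ) 1, ∃ W ∈ Ioo (0 : ℝ) 1, ∃ ε, HasCoordinates x U W ε) ∧
    -- the return map and the return time in coordinates
    (∀ (x : returnDomain) (U W : ℝ) (ε : ℤˣ), HasCoordinates x U W ε →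
      HasCoordinates (returnMap x) (fareyExtension (U, W)).1 (fareyExtension (U, W)).2
        (if U ≤ 1 / 2 then ε else -ε) ∧
      IsLeast (returnTimes x) (returnTime x) ∧
      returnTime x = -(1 / 2) * Real.log ((1 - U) * (1 - W))) ∧
    -- the natural extension of the Farey map is a factor of the return map
    (∃! π : crossSection → ℝ × ℝ, IsCoordinateProjection π) ∧
    (∀ π : crossSection → ℝ × ℝ, IsCoordinateProjection π →
      (∀ x, π x ∈ Icc (0 : ℝ) 1 ×ˢ Icc (0 : ℝ) 1) ∧
      ∀ x : returnDomain, π (returnMap x) = fareyExtension (π ⟨x, x.2.1⟩)) := by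
  refine ⟨crossSection_eq, ?_, fun U hU W hW ε => existsUnique_hasCoordinates hU hW ε, ?_, ?_, ?_,
    existsUnique_coordinateProjection, fun π hπ => ⟨hπ.mem_unitSquare, hπ.semiconj⟩⟩
  · intro x hx
    obtain ⟨U, W, ε, h⟩ := exists_hasCoordinates hx
    obtain ⟨⟨hU, hW⟩, -⟩ := hasCoordinates_iff.mp h
    exact ⟨U, hU, W, hW, ε, h⟩
  · intro x U W ε h U' W' ε'
    refine ⟨hasCoordinates_unique h, ?_⟩
    rintro (⟨rfl, rfl, rfl⟩ | ⟨rfl, rfl, rfl, rfl⟩)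
    · exact h
    · exact h.flip
  · intro x
    constructor
    · intro hx
      obtain ⟨U, W, ε, h⟩ := exists_hasCoordinates hx.1
      obtain ⟨⟨hU, hW⟩, -⟩ := hasCoordinates_iff.mp h
      exact ⟨U, ⟨hU.1, h.lt_one_of_mem_returnDomain hx⟩, W, hW, ε, h⟩
    · rintro ⟨U, hU, W, -, ε, h⟩
      exact ⟨h.mem_crossSection, _, h.isLeast_returnTimes hU.2⟩
  · intro x U W ε h
    have hl := h.isLeast_returnTimes (h.lt_one_of_mem_returnDomain x.2)
    have ht : returnTime x = _ := hl.csInf_eq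
    exact ⟨h.returnMap, ht ▸ hl, ht⟩
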